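/- **Definitions.** Let $\sigma\subset\mathbb C$ be nonempty and compact. For a piecewise linear curve $\gamma:[0,1]\to\mathbb C$ and a line $\ell$ in the plane, $t\in[0,1]$ is (the parameter of) an *entry point* of $\gamma$ on $\ell$ if $\gamma(t)\in\ell$ and either $t=0$ or there is $\varepsilon>0$ with $\gamma(s)\notin\ell$ for all $s\in(t-\varepsilon,t)\cap[0,1]$. Let $\mathrm{vf}(\gamma)$ be the supremum over all lines $\ell$ of the number of entry points of $\gamma$ on $\ell$, and $\rho(\gamma)=1/\mathrm{vf}(\gamma)$. For $f:\sigma\to\mathbb C$ let $\mathrm{cvar}(f,\gamma)$ be the supremum of $\sum_i|f(\gamma(t_{i+1}))-f(\gamma(t_i))|$ over all finite increasing lists of times $t_i\in[0,1]$ with $\gamma(t_i)\in\sigma$, and let $$\mathrm{var}(f,\sigma)=\sup_\gamma \mathrm{cvar}(f,\gamma)\,\rho(\gamma),\qquad \|f\|_{BV(\sigma)}=\sup_\sigma|f|+\mathrm{var}(f,\sigma),$$ the first supremum being over all piecewise linear curves $\gamma$. $BV(\sigma)$ is the algebra of all $f$ with $\|f\|_{BV(\sigma)}<\infty$, and $AC(\sigma)$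 is the closure in $BV(\sigma)$ of the polynomials in $z$ and $\bar z$. A bounded operator $T$ on a complex Banach space $X$ is an *$AC(\sigma)$ operator* if there is an *$AC(\sigma)$ functional calculus* for $T$, that is, a unital algebra homomorphism $\psi:AC(\sigma)\to B(X)$, bounded with respect to $\|\cdot\|_{BV(\sigma)}$, which maps the function $z\mapsto z$ to $T$; one writes $f(T)=\psi(f)$. For $0\le\theta<2\pi$ let $R_\theta=\{(r\cos\theta,r\sin\theta): r\ge 0\}$. **Theorem.** Let $X$ be a complex Banach space, let $N\ge 1$, and let $\theta_1,\dots,\theta_N\in[0,2\pi)$ be distinct. Let $\lambda_{n,m}\in\mathbb C$ and $E_{n,m}\in B(X)$ ($1\le n\le N$, $m\ge 1$) satisfy: * (H1) for each $n$, $\lambda_{n,m}\in R_{\theta_n}$ for all $m$; * (H2) for each $n$, $|\lambda_{n,1}|>|\lambda_{n,2}|>\cdots$ and $\lambda_{n,m}\to 0$ as $m\to\infty$; * (H3) the $E_{n,m}$ are finite rank projections which are pairwise disjoint ($E_{n,m}E_{s,t}=0$ whenever $(n,m)\ne(s,t)$), and $K$ is a constant with $\bigl\|\sum_{m=1}^M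 E_{n,m}\bigr\|\le K$ for all $n$ and all $M\ge 1$. Order the indices by declaring $(n,m)\succ(s,t)$ ($(n,m)$ comes after $(s,t)$) if $|\lambda_{n,m}|<|\lambda_{s,t}|$, or if $|\lambda_{n,m}|=|\lambda_{s,t}|$ and $\theta_n>\theta_s$. Let $\sigma=\{0\}\cup\{\lambda_{n,m}\}_{n,m}$. Then $\succ$ lists the indices as a sequence, and the series $$T=\sum_{n,m}\lambda_{n,m}E_{n,m},$$ with its terms taken in this order, converges in operator norm to a compact $AC(\sigma)$ operator $T$. Moreover $T$ has an $AC(\sigma)$ functional calculus $f\mapsto f(T)$ with $$\|f(T)\|\le(2N+1)\max(1,K)\,\|f\|_{BV(\sigma)}\qquad\text{for all } f\in AC(\sigma).$$ (If some $E_{n,m}\ne 0$ then $K\ge 1$, because $\sum_{m'=1}^{m}E_{n,m'}$ is then a nonzero projection; so the constant is $(2N+1)K$ except when all $E_{n,m}$ vanish and $K<1$.) -/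

import Mathlib

open Filter Topology
open scoped ENNReal

noncomputable section

namespace ACOp

/-! ### Functions of bounded variation on a subset of the plane -/

/-- The piecewise linear curves `γ : [0,1] → ℂ`: there is a partition `0 = t 0 ≤ ⋯ ≤ t n = 1` such
that `γ` is affine on each closed subinterval (continuity on `[0,1]` is then automatic). Only the
values of `γ` on `[0,1]` matter in everything below. -/
def IsPiecewiseLinear (γ : ℝ → ℂ) : Prop :=
  ∃ (n : ℕ) (t : ℕ → ℝ), Monotone t ∧ t 0 = 0 ∧ t n = 1 ∧
    ∀ i < n, ∃ a b : ℂ, ∀ s ∈ Set.Icc (t i) (t (i + 1)), γ s = a + (s : ℂ) * b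

/-- The line `{x + iy : a x + b y = c}` (a genuine line as soon as `(a, b) ≠ (0, 0)`). -/
def line (a b c : ℝ) : Set ℂ := {z | a * z.re + b * z.im = c}

/-- The parameters `t ∈ [0,1]` of the entry points of `γ` on `ℓ`: `γ t ∈ ℓ`, and either `t = 0` or
`γ` is off `ℓ` immediately before the time `t`. -/
def entryPoints (γ : ℝ → ℂ) (ℓ : Set ℂ) : Set ℝ :=
  {t | t ∈ Set.Icc (0 : ℝ) 1 ∧ γ t ∈ ℓ ∧
    (t = 0 ∨ ∃ ε > 0, ∀ s ∈ Set.Icc (0 : ℝ) 1, t - ε < s → s < t → γ s ∉ ℓ)}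

/-- The variation factor of `γ`: the maximal number of entry points of `γ` on a line. -/
def vf (γ : ℝ → ℂ) : ℕ∞ :=
  ⨆ (a : ℝ) (b : ℝ) (c : ℝ) (_ : (a, b) ≠ (0, 0)), (entryPoints γ (line a b c)).encard

/-- `ρ(γ) = 1 / vf(γ)`. -/
def rho (γ : ℝ → ℂ) : ℝ≥0∞ := ((vf γ : ℕ∞) : ℝ≥0∞)⁻¹

/-- The variation of `f : σ → ℂ` along `γ`: the supremum of `∑ |f (γ (t (i+1))) - f (γ (t i))|` over
finite increasing lists of times `t i ∈ [0,1]` with `γ (t i) ∈ σ`. -/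
def cvar {σ : Set ℂ} (f : σ → ℂ) (γ : ℝ → ℂ) : ℝ≥0∞ :=
  eVariationOn (fun t : {t : ℝ // t ∈ Set.Icc (0 : ℝ) 1 ∧ γ t ∈ σ} => f ⟨γ t.1, t.2.2⟩) Set.univ

/-- The variation of `f` on `σ`. -/
def var {σ : Set ℂ} (f : σ → ℂ) : ℝ≥0∞ :=
  ⨆ (γ : ℝ → ℂ) (_ : IsPiecewiseLinear γ), cvar f γ * rho γ

/-- The supremum norm, with values in `[0, ∞]`. -/
def supENorm {σ : Set ℂ} (f : σ → ℂ) : ℝ≥0∞ := ⨆ z, ‖f z‖ₑ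

/-- The `BV(σ)` norm `‖f‖_∞ + var(f, σ)`, with values in `[0, ∞]`. -/
def bvENorm {σ : Set ℂ} (f : σ → ℂ) : ℝ≥0∞ := supENorm f + var f

/-- The `BV(σ)` norm as a real number (meaningful for `f ∈ BV(σ)`). -/
def bvNorm {σ : Set ℂ} (f : σ → ℂ) : ℝ := (bvENorm f).toReal

section Lemmas

variable {σ : Set ℂ}

theorem eVariationOn_le_of_edist {α : Type*} [LinearOrder α] {s : Set α} (f g h : α → ℂ)
    (A B : ℝ≥0∞) (H : ∀ x y, edist (h x) (h y) ≤ A * edist (f x) (f y) + B * edist (g x) (g y)) :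
    eVariationOn h s ≤ A * eVariationOn f s + B * eVariationOn g s := by
  refine iSup_le fun p => ?_
  calc ∑ i ∈ Finset.range p.1, edist (h (p.2.1 (i + 1))) (h (p.2.1 i))
      ≤ ∑ i ∈ Finset.range p.1, (A * edist (f (p.2.1 (i + 1))) (f (p.2.1 i))
          + B * edist (g (p.2.1 (i + 1))) (g (p.2.1 i))) := Finset.sum_le_sum fun i _ => H _ _
    _ = A * ∑ i ∈ Finset.range p.1, edist (f (p.2.1 (i + 1))) (f (p.2.1 i))
          + B * ∑ i ∈ Finset.range p.1, edist (g (p.2.1 (i + 1))) (g (p.2.1 i)) := by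
        rw [Finset.sum_add_distrib, Finset.mul_sum, Finset.mul_sum]
    _ ≤ _ := by
        gcongr
        · exact le_iSup (fun p : ℕ × { u : ℕ → α // Monotone u ∧ ∀ i, u i ∈ s } =>
            ∑ i ∈ Finset.range p.1, edist (f (p.2.1 (i + 1))) (f (p.2.1 i))) p
        · exact le_iSup (fun p : ℕ × { u : ℕ → α // Monotone u ∧ ∀ i, u i ∈ s } =>
            ∑ i ∈ Finset.range p.1, edist (g (p.2.1 (i + 1))) (g (p.2.1 i))) p

theorem var_le_of_edist (f g h : σ → ℂ) (A B : ℝ≥0∞)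
    (H : ∀ x y, edist (h x) (h y) ≤ A * edist (f x) (f y) + B * edist (g x) (g y)) :
    var h ≤ A * var f + B * var g := by
  refine iSup₂_le fun γ hγ => ?_
  have h1 : cvar h γ ≤ A * cvar f γ + B * cvar g γ :=
    eVariationOn_le_of_edist _ _ _ A B fun x y => H _ _
  have hf : cvar f γ * rho γ ≤ var f := le_iSup₂ (f := fun γ _ => cvar f γ * rho γ) γ hγ
  have hg : cvar g γ * rho γ ≤ var g := le_iSup₂ (f := fun γ _ => cvar g γ * rho γ) γ hγ
  calc cvar h γ * rho γ ≤ (A * cvar f γ + B * cvar g γ) * rho γ := by gcongr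
    _ = A * (cvar f γ * rho γ) + B * (cvar g γ * rho γ) := by ring
    _ ≤ _ := by gcongr

theorem le_supENorm (f : σ → ℂ) (z : σ) : ‖f z‖ₑ ≤ supENorm f := le_iSup (fun z => ‖f z‖ₑ) z

theorem bvENorm_add_le (f g : σ → ℂ) : bvENorm (f + g) ≤ bvENorm f + bvENorm g := by
  have h1 : supENorm (f + g) ≤ supENorm f + supENorm g := iSup_le fun z =>
    (enorm_add_le (f z) (g z)).trans (add_le_add (le_supENorm f z) (le_supENorm g z))
  have h2 : var (f + g) ≤ 1 * var f + 1 * var g := var_le_of_edist f g _ 1 1 fun x y => by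
    simpa using edist_add_add_le (f x) (g x) (f y) (g y)
  rw [one_mul, one_mul] at h2
  calc bvENorm (f + g) ≤ (supENorm f + supENorm g) + (var f + var g) := add_le_add h1 h2
    _ = _ := by unfold bvENorm; ring

theorem bvENorm_mul_le (f g : σ → ℂ) : bvENorm (f * g) ≤ bvENorm f * bvENorm g := by
  have h1 : supENorm (f * g) ≤ supENorm f * supENorm g := iSup_le fun z => by
    rw [Pi.mul_apply, enorm_mul]
    exact mul_le_mul' (le_supENorm f z) (le_supENorm g z)
  have h2 : var (f * g) ≤ supENorm g * var f + supENorm f * var g :=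
    var_le_of_edist f g _ _ _ fun x y => by
      simp only [Pi.mul_apply, edist_eq_enorm_sub]
      have e : f x * g x - f y * g y = g x * (f x - f y) + f y * (g x - g y) := by ring
      rw [e]
      refine (enorm_add_le _ _).trans ?_
      rw [enorm_mul, enorm_mul]
      gcongr
      · exact le_supENorm g x
      · exact le_supENorm f y
  calc bvENorm (f * g)
      ≤ supENorm f * supENorm g + (supENorm g * var f + supENorm f * var g) := add_le_add h1 h2
    _ ≤ supENorm f * supENorm g + (supENorm g * var f + supENorm f * var g) + var f * var g :=
        le_self_add
    _ = _ := by unfold bvENorm; ring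

theorem bvENorm_const (c : ℂ) : bvENorm (fun _ : σ => c) ≤ ‖c‖ₑ := by
  have h1 : supENorm (fun _ : σ => c) ≤ ‖c‖ₑ := iSup_le fun _ => le_rfl
  have h2 : var (fun _ : σ => c) ≤ 0 * var (fun _ : σ => c) + 0 * var (fun _ : σ => c) :=
    var_le_of_edist _ _ _ 0 0 fun x y => by simp
  calc bvENorm (fun _ : σ => c) ≤ ‖c‖ₑ + 0 := add_le_add h1 (by simpa using h2)
    _ = _ := add_zero _

end Lemmas

/-- The algebra `BV(σ)`. -/
def BV (σ : Set ℂ) : Subalgebra ℂ (σ → ℂ) where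
  carrier := {f | bvENorm f < ∞}
  add_mem' {f g} hf hg := (bvENorm_add_le f g).trans_lt (ENNReal.add_lt_top.2 ⟨hf, hg⟩)
  mul_mem' {f g} hf hg := (bvENorm_mul_le f g).trans_lt (ENNReal.mul_lt_top hf hg)
  algebraMap_mem' c := (bvENorm_const c).trans_lt enorm_lt_top

/-- The polynomials in `z` and `z̄`, as functions on `σ`. -/
def polynomials (σ : Set ℂ) : Subalgebra ℂ (σ → ℂ) :=
  Algebra.adjoin ℂ {fun z : σ => (z : ℂ), fun z : σ => (starRingEnd ℂ) (z : ℂ)}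

/-- The algebra `AC(σ)` of absolutely continuous functions: the closure in `BV(σ)` of the
polynomials in `z` and `z̄`. -/
def AC (σ : Set ℂ) : Subalgebra ℂ (σ → ℂ) where
  carrier := {f | f ∈ BV σ ∧ ∃ p : ℕ → σ → ℂ, (∀ n, p n ∈ polynomials σ) ∧
    Tendsto (fun n => bvENorm (f - p n)) atTop (𝓝 0)}
  add_mem' := by
    rintro f g ⟨hf, p, hp, hpl⟩ ⟨hg, q, hq, hql⟩
    refine ⟨add_mem hf hg, fun n => p n + q n, fun n => add_mem (hp n) (hq n), ?_⟩
    have h := hpl.add hql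
    rw [add_zero] at h
    refine tendsto_of_tendsto_of_tendsto_of_le_of_le tendsto_const_nhds h (fun _ => zero_le)
      fun n => ?_
    have e : f + g - (p n + q n) = (f - p n) + (g - q n) := by ring
    simpa only [e] using bvENorm_add_le (f - p n) (g - q n)
  mul_mem' := by
    rintro f g ⟨hf, p, hp, hpl⟩ ⟨hg, q, hq, hql⟩
    refine ⟨mul_mem hf hg, fun n => p n * q n, fun n => mul_mem (hp n) (hq n), ?_⟩
    have hf' : bvENorm f ≠ ∞ := ne_of_lt hf
    have hg' : bvENorm g ≠ ∞ := ne_of_lt hg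
    have h1 : Tendsto (fun n => bvENorm (f - p n) * bvENorm g) atTop (𝓝 0) := by
      simpa using ENNReal.Tendsto.mul_const hpl (Or.inr hg')
    have h2 : Tendsto (fun n => bvENorm f * bvENorm (g - q n)) atTop (𝓝 0) := by
      simpa using ENNReal.Tendsto.const_mul hql (Or.inr hf')
    have h3 : Tendsto (fun n => bvENorm (f - p n) * bvENorm (g - q n)) atTop (𝓝 0) := by
      simpa using ENNReal.Tendsto.mul hpl (Or.inr ENNReal.zero_ne_top) hql
        (Or.inr ENNReal.zero_ne_top)
    have h4 : Tendsto (fun n => bvENorm (-1 : σ → ℂ) *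
        (bvENorm (f - p n) * bvENorm (g - q n))) atTop (𝓝 0) := by
      have hc : bvENorm (-1 : σ → ℂ) ≠ ∞ :=
        ne_of_lt ((bvENorm_const (σ := σ) (-1)).trans_lt enorm_lt_top)
      simpa using ENNReal.Tendsto.const_mul h3 (Or.inr hc)
    have h := (h1.add h2).add h4
    simp only [add_zero] at h
    refine tendsto_of_tendsto_of_tendsto_of_le_of_le tendsto_const_nhds h (fun _ => zero_le)
      fun n => ?_
    have e : f * g - p n * q n
        = (f - p n) * g + f * (g - q n) + (-1) * ((f - p n) * (g - q n)) := by ring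
    simp only [e]
    refine (bvENorm_add_le _ _).trans (add_le_add ((bvENorm_add_le _ _).trans
      (add_le_add (bvENorm_mul_le _ _) (bvENorm_mul_le _ _))) ?_)
    exact (bvENorm_mul_le _ _).trans (mul_le_mul' le_rfl (bvENorm_mul_le _ _))
  algebraMap_mem' c := by
    refine ⟨(BV σ).algebraMap_mem c, fun _ => algebraMap ℂ (σ → ℂ) c,
      fun _ => (polynomials σ).algebraMap_mem c, ?_⟩
    have h : bvENorm (fun _ : σ => (0 : ℂ)) = 0 := by
      simpa using bvENorm_const (σ := σ) 0
    have e : algebraMap ℂ (σ → ℂ) c - algebraMap ℂ (σ → ℂ) c = fun _ : σ => (0 : ℂ) := by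
      rw [sub_self]; rfl
    simp only [e, h]
    exact tendsto_const_nhds

/-! ### Operators with an `AC(σ)` functional calculus -/

section Operators

variable {X : Type*} [NormedAddCommGroup X] [NormedSpace ℂ X]

/-- `ψ` is an `AC(σ)` functional calculus for `T`: a unital algebra homomorphism
`AC(σ) → B(X)` that is bounded for the `BV(σ)` norm and sends the identity function to `T`. -/
def IsACFunctionalCalculus (σ : Set ℂ) (T : X →L[ℂ] X) (ψ : AC σ →ₐ[ℂ] (X →L[ℂ] X)) : Prop :=
  (∃ C : ℝ, ∀ f : AC σ, ‖ψ f‖ ≤ C * bvNorm (f : σ → ℂ)) ∧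
    ∃ g : AC σ, (∀ z : σ, (g : σ → ℂ) z = (z : ℂ)) ∧ ψ g = T

/-- `T` is an `AC(σ)` operator. -/
def IsACOperator (σ : Set ℂ) (T : X →L[ℂ] X) : Prop :=
  ∃ ψ : AC σ →ₐ[ℂ] (X →L[ℂ] X), IsACFunctionalCalculus σ T ψ

end Operators

/-! ### Rays, and sums taken in a given order -/

/-- The ray `R_θ`. -/
def ray (θ : ℝ) : Set ℂ := {z | ∃ r : ℝ, 0 ≤ r ∧ z = ⟨r * Real.cos θ, r * Real.sin θ⟩}

/-- `(n, m) ≻ (s, t)`: the index `(n, m)` comes after `(s, t)`. -/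
def Later {N : ℕ} (θ : Fin N → ℝ) (lam : Fin N → ℕ → ℂ) (i j : Fin N × ℕ) : Prop :=
  ‖lam i.1 i.2‖ < ‖lam j.1 j.2‖ ∨ (‖lam i.1 i.2‖ = ‖lam j.1 j.2‖ ∧ θ j.1 < θ i.1)

/-- The sum of the family `a`, taken in the order `r` (`r i j`: the index `i` comes after `j`),
converges to `T`: `r` lists all the indices as a sequence `e 0, e 1, …`, and the partial sums of
`a (e 0) + a (e 1) + ⋯` converge to `T`. -/
def HasSumInOrder {ι B : Type*} [AddCommMonoid B] [TopologicalSpace B]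
    (r : ι → ι → Prop) (a : ι → B) (T : B) : Prop :=
  ∃ e : ℕ ≃ ι, (∀ k l, k < l → r (e l) (e k)) ∧
    Tendsto (fun n => ∑ k ∈ Finset.range n, a (e k)) atTop (𝓝 T)

end ACOp

end

/-!
Write `λ n m`, `E n m` for the eigenvalues and projections. The functional calculus is
`f ↦ f(0) I + ∑ n, ∑ m, (f(λ n m) - f(0)) E n m`.

*Convergence and the bound.* The eigenvalues of one ray lie, in order, on the segment from the first
of them to the origin, and a segment enters each line at most once (`vf_segmentToZero_le`). Hence
the variation of `m ↦ f(λ n m)` is at most `var f` (`sum_edist_le_var_of_ray`). Since `f ∈ AC(σ)` is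
continuous at the origin and the partial sums of `m ↦ E n m` are bounded by `K`, summation by parts
makes each inner series converge in norm with a sum of norm at most `K var f`
(`exists_tendsto_sum_smul`, `exists_tendsto_sum_ray`). The total is at most
`|f(0)| + N K var f ≤ (N + 1) max 1 K ‖f‖`, which is better than required
(`exists_calculus`).

*Multiplicativity.* With only finitely many of the disjoint projections present the formula is a
unital homomorphism by direct computation (`spectralSum_mul`), and pointwise limits inherit this
(`exists_algHom_of_tendsto`).

*The identity function is in `AC(σ)`.* Its variation has to be finite. A curve which passes from one
side of a line to the other in between two sample times has an entry point on that line there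
(`exists_entryPoint`), so at most `vf γ` of the sampling intervals cross a given vertical line.
Integrating over all vertical lines that can be met bounds the variation of the real part along `γ`
by a multiple of `vf γ` (`sum_edist_lineForm_le`), and likewise for the imaginary part. Dividing by
`vf γ` gives a bound independent of `γ` (`bvENorm_coe_lt_top`).

*The order of summation.* Every index has finitely many predecessors, so the order lists the indices
as a sequence, and it lists each ray in its own order. The partial sums are therefore sums of
partial sums over the rays, and they converge to the image of the identity function
(`hasSumInOrder_later`). As a limit of finite rank operators this is compact.
-/

namespace ACOp

/-! ### Variation along piecewise linear curves -/

theorem IsPiecewiseLinear.continuousOn {γ : ℝ → ℂ} (hγ : IsPiecewiseLinear γ) :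
    ContinuousOn γ (Set.Icc 0 1) := by
  obtain ⟨n, t, ht, h0, h1, haff⟩ := hγ
  have key : ∀ j ≤ n, ContinuousOn γ (Set.Icc (t 0) (t j)) := by
    intro j
    induction j with
    | zero => intro _; simp
    | succ j ih =>
      intro hj
      rw [← Set.Icc_union_Icc_eq_Icc (ht (Nat.zero_le j)) (ht (Nat.le_succ j))]
      refine (ih (by omega)).union_of_isClosed ?_ isClosed_Icc isClosed_Icc
      obtain ⟨a, b, hab⟩ := haff j (by omega)
      have hc : Continuous fun s : ℝ => a + (s : ℂ) * b := by fun_prop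
      exact hc.continuousOn.congr hab
  simpa [h0, h1] using key n le_rfl

/-- The linear functional whose level sets are the lines `line a b c`. -/
def lineForm (a b : ℝ) (z : ℂ) : ℝ := a * z.re + b * z.im

theorem continuous_lineForm (a b : ℝ) : Continuous (lineForm a b) := by
  unfold lineForm
  fun_prop

/-- A curve which is off the line `line a b c` at time `p` but not strictly on the same side of it
at time `q` has an entry point in `(p, q]`: the first time after `p` at which the line is met. -/
theorem exists_entryPoint {γ : ℝ → ℂ} (hγ : ContinuousOn γ (Set.Icc 0 1)) {a b c p q : ℝ}
    (hp : 0 ≤ p) (hq : q ≤ 1) (hpq : p ≤ q) (hne : lineForm a b (γ p) ≠ c)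
    (hc : c ∈ Set.uIcc (lineForm a b (γ p)) (lineForm a b (γ q))) :
    ∃ τ ∈ entryPoints γ (line a b c), p < τ ∧ τ ≤ q := by
  have hsub : Set.Icc p q ⊆ Set.Icc (0 : ℝ) 1 := Set.Icc_subset_Icc hp hq
  have hcont : ContinuousOn (fun s => lineForm a b (γ s)) (Set.Icc p q) :=
    (continuous_lineForm a b).comp_continuousOn (hγ.mono hsub)
  have hcomp : IsCompact (Set.Icc p q ∩ (fun s => lineForm a b (γ s)) ⁻¹' {c}) :=
    isCompact_Icc.of_isClosed_subset (hcont.preimage_isClosed_of_isClosed isClosed_Icc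
      isClosed_singleton) Set.inter_subset_left
  have hnonempty : (Set.Icc p q ∩ (fun s => lineForm a b (γ s)) ⁻¹' {c}).Nonempty := by
    rw [← Set.uIcc_of_le hpq] at hcont ⊢
    obtain ⟨s, hs, hsc⟩ := intermediate_value_uIcc hcont hc
    exact ⟨s, hs, hsc⟩
  obtain ⟨τ, ⟨hτ, hτc⟩, hmin⟩ := hcomp.exists_isLeast hnonempty
  have hpτ : p < τ := lt_of_le_of_ne hτ.1 fun h => hne (by rw [h]; exact hτc)
  refine ⟨τ, ⟨hsub hτ, hτc, Or.inr ⟨τ - p, by linarith, fun s _ hs1 hs2 hs => ?_⟩⟩, hpτ, hτ.2⟩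
  exact absurd (hmin ⟨⟨by linarith, by linarith [hτ.2]⟩, hs⟩) (not_le.2 hs2)

theorem encard_entryPoints_le_vf (γ : ℝ → ℂ) {a b : ℝ} (hab : (a, b) ≠ (0, 0)) (c : ℝ) :
    (entryPoints γ (line a b c)).encard ≤ vf γ :=
  le_iSup_of_le a <| le_iSup_of_le b <| le_iSup_of_le c <| le_iSup_of_le hab le_rfl

/-- The number of sampling intervals over which a curve strictly crosses a line is at most its
variation factor: distinct intervals have distinct entry points. -/
theorem card_crossings_le_vf {γ : ℝ → ℂ} (hγ : ContinuousOn γ (Set.Icc 0 1)) {a b : ℝ}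
    (hab : (a, b) ≠ (0, 0)) (c : ℝ) {t : ℕ → ℝ} (ht : Monotone t)
    (ht01 : ∀ i, t i ∈ Set.Icc (0 : ℝ) 1) (I : Finset ℕ)
    (hI : ∀ i ∈ I, c ∈ Set.Ioo (min (lineForm a b (γ (t i))) (lineForm a b (γ (t (i + 1)))))
      (max (lineForm a b (γ (t i))) (lineForm a b (γ (t (i + 1)))))) :
    (I.card : ℕ∞) ≤ vf γ := by
  have hex : ∀ i ∈ I, ∃ τ ∈ entryPoints γ (line a b c), t i < τ ∧ τ ≤ t (i + 1) := by
    intro i hi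
    refine exists_entryPoint hγ (ht01 i).1 (ht01 (i + 1)).2 (ht (Nat.le_succ i)) ?_
      (Set.Ioo_subset_Icc_self (hI i hi))
    rintro rfl
    have h := hI i hi
    rcases le_total (lineForm a b (γ (t i))) (lineForm a b (γ (t (i + 1)))) with h' | h'
    · exact absurd h.1 (by simp [h'])
    · exact absurd h.2 (by simp [h'])
  choose! τ hτ hτ1 hτ2 using hex
  have hlt : ∀ i ∈ I, ∀ j ∈ I, i < j → τ i < τ j := fun i hi j hj hij =>
    ((hτ2 i hi).trans (ht hij)).trans_lt (hτ1 j hj)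
  have hinj : Set.InjOn τ I := by
    intro i hi j hj hij
    rcases lt_trichotomy i j with h | h | h
    · exact absurd hij (hlt i hi j hj h).ne
    · exact h
    · exact absurd hij (hlt j hj i hi h).ne'
  rw [← Set.encard_coe_eq_coe_finsetCard]
  exact (Set.encard_le_encard_of_injOn (fun i hi => hτ i hi) hinj).trans
    (encard_entryPoints_le_vf γ hab c)

/-- A one-sided form of Banach's indicatrix theorem: integrating the number of crossings of the
lines `line a b c` over `c` bounds the variation of a linear functional along a sampled curve. -/
theorem sum_edist_lineForm_le {γ : ℝ → ℂ} (hγ : ContinuousOn γ (Set.Icc 0 1)) {a b : ℝ}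
    (hab : (a, b) ≠ (0, 0)) {A B : ℝ} {t : ℕ → ℝ} (ht : Monotone t)
    (ht01 : ∀ i, t i ∈ Set.Icc (0 : ℝ) 1)
    (hAB : ∀ i, lineForm a b (γ (t i)) ∈ Set.Icc A B) (n : ℕ) :
    ∑ i ∈ Finset.range n, edist (lineForm a b (γ (t (i + 1)))) (lineForm a b (γ (t i)))
      ≤ ((vf γ : ℕ∞) : ℝ≥0∞) * ENNReal.ofReal (B - A) := by
  classical
  set x : ℕ → ℝ := fun i => lineForm a b (γ (t i)) with hx
  set J : ℕ → Set ℝ := fun i => Set.Ioo (min (x i) (x (i + 1))) (max (x i) (x (i + 1))) with hJ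
  have hpt : ∀ c, ∑ i ∈ Finset.range n, (J i).indicator (fun _ => (1 : ℝ≥0∞)) c
      ≤ (Set.Icc A B).indicator (fun _ => ((vf γ : ℕ∞) : ℝ≥0∞)) c := by
    intro c
    have hcard : ∑ i ∈ Finset.range n, (J i).indicator (fun _ => (1 : ℝ≥0∞)) c
        = ((Finset.range n).filter fun i => c ∈ J i).card := by
      rw [Finset.card_filter, Nat.cast_sum]
      refine Finset.sum_congr rfl fun i _ => ?_
      by_cases hi : c ∈ J i <;> simp [hi]
    by_cases hc : c ∈ Set.Icc A B
    · rw [hcard, Set.indicator_of_mem hc]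
      have h := card_crossings_le_vf hγ hab c ht ht01 ((Finset.range n).filter fun i => c ∈ J i)
        fun i hi => (Finset.mem_filter.1 hi).2
      exact_mod_cast h
    · rw [Set.indicator_of_notMem hc, nonpos_iff_eq_zero]
      refine Finset.sum_eq_zero fun i _ => Set.indicator_of_notMem (fun hi => hc ?_) _
      exact ⟨(le_min (hAB i).1 (hAB (i + 1)).1).trans hi.1.le,
        hi.2.le.trans (max_le (hAB i).2 (hAB (i + 1)).2)⟩
  calc ∑ i ∈ Finset.range n, edist (x (i + 1)) (x i)
      = ∑ i ∈ Finset.range n, ∫⁻ c, (J i).indicator (fun _ => (1 : ℝ≥0∞)) c := by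
        refine Finset.sum_congr rfl fun i _ => ?_
        rw [MeasureTheory.lintegral_indicator measurableSet_Ioo,
          MeasureTheory.setLIntegral_const, one_mul, Real.volume_Ioo, max_sub_min_eq_abs,
          edist_dist, Real.dist_eq]
    _ = ∫⁻ c, ∑ i ∈ Finset.range n, (J i).indicator (fun _ => (1 : ℝ≥0∞)) c :=
        (MeasureTheory.lintegral_finsetSum _ fun i _ =>
          measurable_const.indicator measurableSet_Ioo).symm
    _ ≤ ∫⁻ c, (Set.Icc A B).indicator (fun _ => ((vf γ : ℕ∞) : ℝ≥0∞)) c :=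
        MeasureTheory.lintegral_mono hpt
    _ = _ := by
        rw [MeasureTheory.lintegral_indicator measurableSet_Icc,
          MeasureTheory.setLIntegral_const, Real.volume_Icc]

theorem edist_le_edist_re_add_edist_im (z w : ℂ) :
    edist z w ≤ edist z.re w.re + edist z.im w.im := by
  simp only [edist_dist, ← ENNReal.ofReal_add dist_nonneg dist_nonneg]
  refine ENNReal.ofReal_le_ofReal ?_
  rw [dist_eq_norm, Real.dist_eq, Real.dist_eq]
  simpa using Complex.norm_le_abs_re_add_abs_im (z - w)

/-- The identity function varies along `γ` by at most a multiple of `vf γ`, because its real and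
imaginary parts do. -/
theorem cvar_coe_le {σ : Set ℂ} {R : ℝ} (hR : ∀ z ∈ σ, ‖z‖ ≤ R) {γ : ℝ → ℂ}
    (hγ : IsPiecewiseLinear γ) :
    cvar (fun z : σ => (z : ℂ)) γ ≤ ENNReal.ofReal (4 * R) * ((vf γ : ℕ∞) : ℝ≥0∞) := by
  refine iSup_le fun p => ?_
  obtain ⟨n, u, hu, -⟩ := p
  have hmono : Monotone fun i => (u i : ℝ) := fun i j hij => hu hij
  have h01 : ∀ i, (u i : ℝ) ∈ Set.Icc (0 : ℝ) 1 := fun i => (u i).2.1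
  have hnorm : ∀ i, ‖γ (u i)‖ ≤ R := fun i => hR _ (u i).2.2
  have hre := sum_edist_lineForm_le hγ.continuousOn (a := 1) (b := 0) (by simp) hmono h01
    (A := -R) (B := R)
    (fun i => abs_le.1 (by simpa [lineForm] using (Complex.abs_re_le_norm _).trans (hnorm i))) n
  have him := sum_edist_lineForm_le hγ.continuousOn (a := 0) (b := 1) (by simp) hmono h01
    (A := -R) (B := R)
    (fun i => abs_le.1 (by simpa [lineForm] using (Complex.abs_im_le_norm _).trans (hnorm i))) n
  have hR0 : 0 ≤ R := (norm_nonneg _).trans (hnorm 0)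
  calc ∑ i ∈ Finset.range n, edist (γ (u (i + 1))) (γ (u i))
      ≤ ∑ i ∈ Finset.range n, (edist (lineForm 1 0 (γ (u (i + 1)))) (lineForm 1 0 (γ (u i)))
          + edist (lineForm 0 1 (γ (u (i + 1)))) (lineForm 0 1 (γ (u i)))) :=
        Finset.sum_le_sum fun i _ => by
          simpa [lineForm] using edist_le_edist_re_add_edist_im (γ (u (i + 1))) (γ (u i))
    _ ≤ ((vf γ : ℕ∞) : ℝ≥0∞) * ENNReal.ofReal (R - -R)
          + ((vf γ : ℕ∞) : ℝ≥0∞) * ENNReal.ofReal (R - -R) := by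
        rw [Finset.sum_add_distrib]
        exact add_le_add hre him
    _ = _ := by
        rw [← mul_add, ← ENNReal.ofReal_add (by linarith) (by linarith), mul_comm]
        congr 2
        ring

/-- On a bounded set the identity function has finite `BV` norm. -/
theorem bvENorm_coe_lt_top {σ : Set ℂ} (hσ : Bornology.IsBounded σ) :
    bvENorm (fun z : σ => (z : ℂ)) < ∞ := by
  obtain ⟨R, hR⟩ := hσ.exists_norm_le
  have h1 : supENorm (fun z : σ => (z : ℂ)) ≤ ENNReal.ofReal R := iSup_le fun z => by
    rw [← ofReal_norm]
    exact ENNReal.ofReal_le_ofReal (hR z z.2)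
  have h2 : var (fun z : σ => (z : ℂ)) ≤ ENNReal.ofReal (4 * R) := iSup₂_le fun γ hγ => by
    calc cvar (fun z : σ => (z : ℂ)) γ * rho γ
        ≤ ENNReal.ofReal (4 * R) * ((vf γ : ℕ∞) : ℝ≥0∞) * rho γ := by
          gcongr
          exact cvar_coe_le hR hγ
      _ = ENNReal.ofReal (4 * R) * (((vf γ : ℕ∞) : ℝ≥0∞) * ((vf γ : ℕ∞) : ℝ≥0∞)⁻¹) := by
          rw [mul_assoc, rho]
      _ ≤ ENNReal.ofReal (4 * R) * 1 := by
          gcongr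
          exact ENNReal.mul_inv_le_one _
      _ = _ := mul_one _
  exact (add_le_add h1 h2).trans_lt
    (ENNReal.add_lt_top.2 ⟨ENNReal.ofReal_lt_top, ENNReal.ofReal_lt_top⟩)

theorem coe_mem_AC {σ : Set ℂ} (hσ : Bornology.IsBounded σ) :
    (fun z : σ => (z : ℂ)) ∈ AC σ := by
  refine ⟨bvENorm_coe_lt_top hσ, fun _ => fun z : σ => (z : ℂ),
    fun _ => Algebra.subset_adjoin (by simp), ?_⟩
  have h : bvENorm (fun _ : σ => (0 : ℂ)) = 0 := by simpa using bvENorm_const (σ := σ) 0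
  have e : (fun z : σ => (z : ℂ)) - (fun z : σ => (z : ℂ)) = fun _ => 0 := by
    rw [sub_self]; rfl
  simp only [e, h]
  exact tendsto_const_nhds

/-! ### Variation along a ray, and continuity on `AC(σ)` -/

/-- The segment from `w` to `0`, run through at constant speed during `[0,1]`. -/
def segmentToZero (w : ℂ) (s : ℝ) : ℂ := w + (s : ℂ) * (-w)

theorem isPiecewiseLinear_segmentToZero (w : ℂ) : IsPiecewiseLinear (segmentToZero w) := by
  refine ⟨1, fun i => if i = 0 then 0 else 1, ?_, by simp, by simp,
    fun i _ => ⟨w, -w, fun s _ => rfl⟩⟩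
  intro i j hij
  rcases Nat.eq_zero_or_pos i with rfl | hi
  · by_cases hj : j = 0 <;> simp [hj]
  · simp [hi.ne', (hi.trans_le hij).ne']

/-- A segment enters each line at most once. -/
theorem vf_segmentToZero_le (w : ℂ) : vf (segmentToZero w) ≤ 1 := by
  refine iSup_le fun a => iSup_le fun b => iSup_le fun c => iSup_le fun _ => ?_
  rw [Set.encard_le_one_iff]
  have key : ∀ s t, s ∈ entryPoints (segmentToZero w) (line a b c) →
      t ∈ entryPoints (segmentToZero w) (line a b c) → ¬ s < t := by
    intro s t hs ht hst
    have hs2 := hs.2.1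
    have ht2 := ht.2.1
    simp only [line, segmentToZero, Set.mem_ofPred_eq, Complex.add_re, Complex.add_im,
      Complex.mul_re, Complex.mul_im, Complex.ofReal_re, Complex.ofReal_im, Complex.neg_re,
      Complex.neg_im] at hs2 ht2
    -- two different points of the line force the whole segment onto it
    have hzero : a * w.re + b * w.im = 0 := by
      have : (t - s) * (a * w.re + b * w.im) = 0 := by linear_combination hs2 - ht2
      exact (mul_eq_zero.1 this).resolve_left (sub_pos.2 hst).ne'
    have hall : ∀ r, segmentToZero w r ∈ line a b c := by
      intro r
      simp only [line, segmentToZero, Set.mem_ofPred_eq, Complex.add_re, Complex.add_im,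
        Complex.mul_re, Complex.mul_im, Complex.ofReal_re, Complex.ofReal_im, Complex.neg_re,
        Complex.neg_im]
      linear_combination hs2 + (s - r) * hzero
    have ht0 : 0 < t := hs.1.1.trans_lt hst
    rcases ht.2.2 with h | ⟨ε, hε, h⟩
    · exact ht0.ne' h
    · have hmax : max (t / 2) (t - ε / 2) < t := max_lt (by linarith) (by linarith)
      have hm1 := le_max_left (t / 2) (t - ε / 2)
      have hm2 := le_max_right (t / 2) (t - ε / 2)
      exact h _ ⟨by linarith, by linarith [ht.1.2]⟩ (by linarith) hmax (hall _)
  intro s t hs ht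
  exact le_antisymm (not_lt.1 (key t s ht hs)) (not_lt.1 (key s t hs ht))

theorem cvar_segmentToZero_le {σ : Set ℂ} (f : σ → ℂ) (w : ℂ) :
    cvar f (segmentToZero w) ≤ var f := by
  have h1 : 1 ≤ rho (segmentToZero w) := by
    rw [rho, ENNReal.one_le_inv]
    exact_mod_cast vf_segmentToZero_le w
  calc cvar f (segmentToZero w) ≤ cvar f (segmentToZero w) * rho (segmentToZero w) :=
        le_mul_of_one_le_right' h1
    _ ≤ var f := le_iSup₂ (f := fun γ _ => cvar f γ * rho γ) _ (isPiecewiseLinear_segmentToZero w)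

/-- The variation of `f` along a sequence of points of a ray moving towards the origin. -/
theorem sum_edist_le_var_of_ray {σ : Set ℂ} (f : σ → ℂ) {θ : ℝ} (z : ℕ → σ)
    (hz : ∀ m, (z m : ℂ) ∈ ray θ) (hanti : Antitone fun m => ‖(z m : ℂ)‖) (n : ℕ) :
    ∑ m ∈ Finset.range n, edist (f (z (m + 1))) (f (z m)) ≤ var f := by
  set d : ℂ := ⟨Real.cos θ, Real.sin θ⟩ with hd
  have hdn : ‖d‖ = 1 := by
    rw [Complex.norm_def, Complex.normSq_mk, ← pow_two, ← pow_two, Real.cos_sq_add_sin_sq,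
      Real.sqrt_one]
  have hpolar : ∀ m, (z m : ℂ) = (‖(z m : ℂ)‖ : ℂ) * d := by
    intro m
    obtain ⟨r, hr, h⟩ := hz m
    have h' : (z m : ℂ) = (r : ℂ) * d := by
      rw [h]; apply Complex.ext <;> simp [hd]
    rw [h', norm_mul, hdn, Complex.norm_real, Real.norm_of_nonneg hr, mul_one]
  rcases (norm_nonneg (z 0 : ℂ)).eq_or_lt with h0 | h0
  · have hconst : ∀ m, z m = z 0 := fun m => Subtype.ext <| by
      have hm : ‖(z m : ℂ)‖ ≤ 0 := h0 ▸ hanti (Nat.zero_le m)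
      rw [norm_le_zero_iff.1 hm, norm_eq_zero.1 h0.symm]
    rw [Finset.sum_eq_zero fun m _ => by rw [hconst (m + 1), hconst m, edist_self]]
    exact zero_le
  · -- `t m` is the time at which the segment from `z 0` to the origin passes through `z m`
    set t : ℕ → ℝ := fun m => 1 - ‖(z m : ℂ)‖ / ‖(z 0 : ℂ)‖ with ht
    have hγ : ∀ m, segmentToZero (z 0) (t m) = z m := by
      intro m
      have hne : ((‖(z 0 : ℂ)‖ : ℝ) : ℂ) ≠ 0 := by exact_mod_cast h0.ne'
      have e : segmentToZero (z 0) (t m) = ((‖(z m : ℂ)‖ / ‖(z 0 : ℂ)‖ : ℝ) : ℂ) * (z 0 : ℂ) := by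
        simp only [segmentToZero, ht]; push_cast; ring
      rw [e, Complex.ofReal_div]
      conv_lhs => rw [hpolar 0]
      conv_rhs => rw [hpolar m]
      rw [norm_mul, hdn, Complex.norm_real, norm_norm, mul_one]
      field_simp
    have hmem : ∀ m, t m ∈ Set.Icc (0 : ℝ) 1 ∧ segmentToZero (z 0) (t m) ∈ σ := by
      intro m
      refine ⟨⟨?_, ?_⟩, by rw [hγ]; exact (z m).2⟩
      · have : ‖(z m : ℂ)‖ / ‖(z 0 : ℂ)‖ ≤ 1 := (div_le_one h0).2 (hanti (Nat.zero_le m))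
        simp only [ht]; linarith
      · have : 0 ≤ ‖(z m : ℂ)‖ / ‖(z 0 : ℂ)‖ := by positivity
        simp only [ht]; linarith
    refine le_trans ?_ (cvar_segmentToZero_le f (z 0))
    let u : ℕ → {t : ℝ // t ∈ Set.Icc (0 : ℝ) 1 ∧ segmentToZero (z 0) t ∈ σ} :=
      fun m => ⟨t m, hmem m⟩
    have hu : Monotone u := by
      intro i j hij
      have : ‖(z j : ℂ)‖ / ‖(z 0 : ℂ)‖ ≤ ‖(z i : ℂ)‖ / ‖(z 0 : ℂ)‖ := by
        gcongr
        exact hanti hij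
      change t i ≤ t j
      simp only [ht]; linarith
    have h := eVariationOn.sum_le (n := n)
      (f := fun t : {t : ℝ // t ∈ Set.Icc (0 : ℝ) 1 ∧ segmentToZero (z 0) t ∈ σ} =>
        f ⟨segmentToZero (z 0) t.1, t.2.2⟩) (s := Set.univ) hu fun _ => Set.mem_univ _
    have e : ∀ m, (⟨segmentToZero (z 0) (t m), (hmem m).2⟩ : σ) = z m :=
      fun m => Subtype.ext (hγ m)
    simp only [u, e] at h
    exact h

theorem continuous_of_mem_polynomials {σ : Set ℂ} {p : σ → ℂ} (hp : p ∈ polynomials σ) :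
    Continuous p := by
  refine Algebra.adjoin_induction ?_ (fun c => continuous_const) (fun _ _ _ _ h1 h2 => h1.add h2)
    (fun _ _ _ _ h1 h2 => h1.mul h2) hp
  rintro q (rfl | rfl)
  · exact continuous_subtype_val
  · exact Complex.continuous_conj.comp continuous_subtype_val

/-- Functions in `AC(σ)` are uniform limits of polynomials in `z` and `z̄`. -/
theorem continuous_of_mem_AC {σ : Set ℂ} {f : σ → ℂ} (hf : f ∈ AC σ) : Continuous f := by
  obtain ⟨-, p, hp, hlim⟩ := hf
  have hunif : TendstoUniformly p f atTop := by
    rw [Metric.tendstoUniformly_iff]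
    intro ε hε
    have hε' : (0 : ℝ≥0∞) < ENNReal.ofReal ε := ENNReal.ofReal_pos.2 hε
    filter_upwards [hlim.eventually_lt_const hε'] with n hn z
    have h : ‖f z - p n z‖ₑ < ENNReal.ofReal ε :=
      ((le_supENorm (f - p n) z).trans le_self_add).trans_lt hn
    rw [← ofReal_norm, ENNReal.ofReal_lt_ofReal_iff hε] at h
    rwa [dist_eq_norm]
  exact hunif.continuous (Frequently.of_forall fun n => continuous_of_mem_polynomials (hp n))

theorem bvENorm_lt_top_of_mem_AC {σ : Set ℂ} {f : σ → ℂ} (hf : f ∈ AC σ) : bvENorm f < ∞ := hf.1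

/-! ### Sums of disjoint projections -/

/-- Summation by parts: a series with coefficients of bounded variation tending to `0` and with
bounded partial sums `∑ E m` converges, and its sum is bounded by the variation of the
coefficients. -/
theorem exists_tendsto_sum_smul {B : Type*} [NormedAddCommGroup B] [NormedSpace ℂ B]
    [CompleteSpace B] {g : ℕ → ℂ} {E : ℕ → B} {K V : ℝ} (hg : Tendsto g atTop (𝓝 0))
    (hV : ∀ n, ∑ m ∈ Finset.range n, ‖g (m + 1) - g m‖ ≤ V)
    (hK : ∀ M, ‖∑ m ∈ Finset.range (M + 1), E m‖ ≤ K) :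
    ∃ L : B, Tendsto (fun M => ∑ m ∈ Finset.range M, g m • E m) atTop (𝓝 L) ∧ ‖L‖ ≤ K * V := by
  have hK0 : 0 ≤ K := (norm_nonneg _).trans (hK 0)
  let S : ℕ → B := fun m => ∑ i ∈ Finset.range (m + 1), E i
  have hbound : ∀ m, ‖(g (m + 1) - g m) • S m‖ ≤ ‖g (m + 1) - g m‖ * K := fun m => by
    rw [norm_smul]
    exact mul_le_mul_of_nonneg_left (hK m) (norm_nonneg _)
  have hsumg : Summable fun m => ‖g (m + 1) - g m‖ :=
    summable_of_sum_range_le (fun _ => norm_nonneg _) hV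
  have hsum : Summable fun m => (g (m + 1) - g m) • S m :=
    Summable.of_norm_bounded (hsumg.mul_right K) hbound
  refine ⟨-∑' m, (g (m + 1) - g m) • S m, ?_, ?_⟩
  · rw [← tendsto_add_atTop_iff_nat 1]
    have hboundary : Tendsto (fun M => g M • S M) atTop (𝓝 0) := by
      refine squeeze_zero_norm (a := fun M => ‖g M‖ * K) (fun M => ?_) ?_
      · rw [norm_smul]
        exact mul_le_mul_of_nonneg_left (hK M) (norm_nonneg _)
      · simpa using hg.norm.mul_const K
    have h := hboundary.sub hsum.hasSum.tendsto_sum_nat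
    rw [zero_sub] at h
    refine h.congr fun M => ?_
    rw [Finset.sum_range_by_parts g E (M + 1), Nat.add_sub_cancel]
  · rw [norm_neg]
    calc ‖∑' m, (g (m + 1) - g m) • S m‖ ≤ ∑' m, ‖g (m + 1) - g m‖ * K :=
          tsum_of_norm_bounded (hsumg.mul_right K).hasSum hbound
      _ = (∑' m, ‖g (m + 1) - g m‖) * K := tsum_mul_right
      _ ≤ V * K := by
          gcongr
          exact Real.tsum_le_of_sum_range_le (fun _ => norm_nonneg _) hV
      _ = K * V := mul_comm _ _

section Calculus

variable {ι A : Type*} [Ring A] [Algebra ℂ A]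

/-- The element which acts as `f i` on the range of the projection `E i`, `i ∈ s`, and as the
scalar `c` on the complementary subspace. -/
def spectralSum (E : ι → A) (s : Finset ι) (c : ℂ) (f : ι → ℂ) : A :=
  c • (1 : A) + ∑ i ∈ s, (f i - c) • E i

theorem spectralSum_mul {E : ι → A} (hE : ∀ i, IsIdempotentElem (E i))
    (hdisj : ∀ i j, i ≠ j → E i * E j = 0) (s : Finset ι) (c d : ℂ) (f g : ι → ℂ) :
    spectralSum E s (c * d) (fun i => f i * g i) = spectralSum E s c f * spectralSum E s d g := by
  classical
  have hprod : (∑ i ∈ s, (f i - c) • E i) * ∑ i ∈ s, (g i - d) • E i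
      = ∑ i ∈ s, ((f i - c) * (g i - d)) • E i := by
    rw [Finset.sum_mul_sum]
    refine Finset.sum_congr rfl fun i hi => ?_
    rw [Finset.sum_eq_single_of_mem i hi fun j _ hj => by
      rw [smul_mul_smul_comm, hdisj i j hj.symm, smul_zero], smul_mul_smul_comm, hE i]
  simp only [spectralSum]
  rw [mul_add, add_mul, add_mul, hprod]
  simp only [smul_mul_assoc, mul_smul_comm, one_mul, mul_one, Finset.smul_sum, smul_smul]
  rw [add_assoc, mul_comm d c, ← Finset.sum_add_distrib, ← Finset.sum_add_distrib]
  congr 1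
  refine Finset.sum_congr rfl fun i _ => ?_
  rw [← add_smul, ← add_smul]
  congr 1
  ring

theorem spectralSum_add (E : ι → A) (s : Finset ι) (c d : ℂ) (f g : ι → ℂ) :
    spectralSum E s (c + d) (fun i => f i + g i) = spectralSum E s c f + spectralSum E s d g := by
  simp only [spectralSum]
  rw [add_add_add_comm, ← Finset.sum_add_distrib, add_smul]
  congr 1
  refine Finset.sum_congr rfl fun i _ => ?_
  rw [← add_smul]
  congr 1
  ring

theorem spectralSum_const (E : ι → A) (s : Finset ι) (c : ℂ) :
    spectralSum E s c (fun _ => c) = algebraMap ℂ A c := by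
  simp [spectralSum, Algebra.algebraMap_eq_smul_one]

end Calculus

theorem isCompactOperator_of_finiteDimensional_range {X : Type*} [NormedAddCommGroup X]
    [NormedSpace ℂ X] (E : X →L[ℂ] X)
    (h : FiniteDimensional ℂ (LinearMap.range (E : X →ₗ[ℂ] X))) : IsCompactOperator E := by
  have : ProperSpace (LinearMap.range (E : X →ₗ[ℂ] X)) := FiniteDimensional.proper ℂ _
  let F : X →L[ℂ] LinearMap.range (E : X →ₗ[ℂ] X) :=
    E.codRestrict _ fun x => LinearMap.mem_range_self _ x
  have hid : IsCompactOperator (id : LinearMap.range (E : X →ₗ[ℂ] X) → _) := isCompactOperator_id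
  exact (hid.comp_clm F).clm_comp (LinearMap.range (E : X →ₗ[ℂ] X)).subtypeL

/-! ### Listing the eigenvalues by decreasing modulus -/

section Order

variable {N : ℕ} {θ : Fin N → ℝ} {lam : Fin N → ℕ → ℂ}

theorem Later.irrefl (i : Fin N × ℕ) : ¬ Later θ lam i i := by
  simp [Later]

theorem Later.trans {i j k : Fin N × ℕ} (h1 : Later θ lam i j) (h2 : Later θ lam j k) :
    Later θ lam i k := by
  rcases h1 with h1 | ⟨h1, h1'⟩ <;> rcases h2 with h2 | ⟨h2, h2'⟩
  · exact Or.inl (h1.trans h2)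
  · exact Or.inl (h2 ▸ h1)
  · exact Or.inl (h1 ▸ h2)
  · exact Or.inr ⟨h1.trans h2, h2'.trans h1'⟩

theorem Later.trichotomy (hθ : Function.Injective θ) (hanti : ∀ n, StrictAnti fun m => ‖lam n m‖)
    (i j : Fin N × ℕ) : Later θ lam i j ∨ i = j ∨ Later θ lam j i := by
  rcases lt_trichotomy ‖lam i.1 i.2‖ ‖lam j.1 j.2‖ with h | h | h
  · exact Or.inl (Or.inl h)
  · rcases lt_trichotomy (θ i.1) (θ j.1) with h' | h' | h'
    · exact Or.inr (Or.inr (Or.inr ⟨h.symm, h'⟩))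
    · have h1 : i.1 = j.1 := hθ h'
      rw [h1] at h
      exact Or.inr (Or.inl (Prod.ext h1 ((hanti j.1).injective h)))
    · exact Or.inl (Or.inr ⟨h, h'⟩)
  · exact Or.inr (Or.inr (Or.inl h))

theorem finite_setOf_later (hanti : ∀ n, StrictAnti fun m => ‖lam n m‖)
    (hlim : ∀ n, Tendsto (lam n) atTop (𝓝 0)) (i : Fin N × ℕ) :
    {j | Later θ lam i j}.Finite := by
  have hpos : 0 < ‖lam i.1 i.2‖ := (norm_nonneg _).trans_lt (hanti i.1 (Nat.lt_succ_self i.2))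
  have hev : ∀ᶠ m in atTop, ∀ n, ‖lam n m‖ < ‖lam i.1 i.2‖ := eventually_all.2 fun n => by
    have h := (hlim n).norm
    rw [norm_zero] at h
    exact h.eventually_lt_const hpos
  obtain ⟨M, hM⟩ := eventually_atTop.1 hev
  refine (Finset.univ ×ˢ Finset.range M : Finset (Fin N × ℕ)).finite_toSet.subset ?_
  rintro ⟨n, m⟩ hj
  have hle : ‖lam i.1 i.2‖ ≤ ‖lam n m‖ := by
    rcases hj with h | h
    · exact h.le
    · exact h.1.le
  simp only [Finset.coe_product, Finset.coe_univ, Set.mem_prod, Set.mem_univ, true_and,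
    Finset.coe_range, Set.mem_Iio]
  by_contra hmM
  exact absurd hle (not_le.2 (hM m (not_lt.1 hmM) n))

/-- A strict linear order on an infinite type all of whose initial segments are finite lists the
type as a sequence; here the sequence is obtained by counting predecessors. -/
theorem exists_equiv_of_finite_predecessors {ι : Type*} [Infinite ι] {r : ι → ι → Prop}
    (hirr : ∀ i, ¬ r i i) (htrans : ∀ i j k, r i j → r j k → r i k)
    (htri : ∀ i j, r i j ∨ i = j ∨ r j i) (hfin : ∀ i, {j | r i j}.Finite) :
    ∃ e : ℕ ≃ ι, ∀ k l, k < l → r (e l) (e k) := by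
  classical
  let rk : ι → ℕ := fun i => {j | r i j}.ncard
  have hmono : ∀ i j, r i j → rk j < rk i := fun i j hij =>
    Set.ncard_lt_ncard (by
      refine (Set.ssubset_iff_of_subset fun k hk => htrans i j k hij hk).2 ⟨j, hij, hirr j⟩)
      (hfin i)
  have hinj : Function.Injective rk := by
    intro i j hij
    rcases htri i j with h | h | h
    · exact absurd hij (hmono i j h).ne'
    · exact h
    · exact absurd hij (hmono j i h).ne
  have : Infinite (Set.range rk) := (Set.infinite_range_of_injective hinj).to_subtype
  let o := Nat.Subtype.orderIsoOfNat (Set.range rk)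
  let q := Equiv.ofInjective rk hinj
  have hq : ∀ k, rk (q.symm (o k)) = o k := fun k =>
    congrArg Subtype.val (q.apply_symm_apply (o k))
  refine ⟨o.toEquiv.trans q.symm, fun k l hkl => ?_⟩
  have hlt : rk (q.symm (o k)) < rk (q.symm (o l)) := by
    rw [hq, hq]
    exact o.strictMono hkl
  rcases htri (q.symm (o l)) (q.symm (o k)) with h | h | h
  · exact h
  · rw [h] at hlt; exact absurd hlt (lt_irrefl _)
  · exact absurd (hmono _ _ h) (not_lt.2 hlt.le)

/-- If the sum over each row converges, then so do the sums along any enumeration of the indices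
which lists every row in its natural order: its partial sums run over initial segments of the
rows. -/
theorem tendsto_sum_range_of_rows {B : Type*} [AddCommMonoid B] [TopologicalSpace B]
    [ContinuousAdd B] (e : ℕ ≃ Fin N × ℕ) (he : ∀ n, StrictMono fun m => e.symm (n, m))
    (a : Fin N × ℕ → B) (S : Fin N → B)
    (hS : ∀ n, Tendsto (fun M => ∑ m ∈ Finset.range M, a (n, m)) atTop (𝓝 (S n))) :
    Tendsto (fun k => ∑ i ∈ Finset.range k, a (e i)) atTop (𝓝 (∑ n, S n)) := by
  have hex : ∀ n k, ∃ m, k ≤ e.symm (n, m) := fun n k => ⟨k, (he n).id_le k⟩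
  let M : Fin N → ℕ → ℕ := fun n k => Nat.find (hex n k)
  have hM : ∀ n k m, m < M n k ↔ e.symm (n, m) < k := by
    intro n k m
    rw [Nat.lt_find_iff]
    exact ⟨fun h => not_le.1 (h m le_rfl),
      fun h m' hm' => not_le.2 (((he n).monotone hm').trans_lt h)⟩
  have hMlim : ∀ n, Tendsto (M n) atTop atTop := fun n => tendsto_atTop.2 fun b => by
    filter_upwards [eventually_gt_atTop (e.symm (n, b))] with k hk
    exact ((hM n k b).2 hk).le
  have hsum : ∀ k, ∑ i ∈ Finset.range k, a (e i)
      = ∑ n, ∑ m ∈ Finset.range (M n k), a (n, m) := by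
    intro k
    rw [← Finset.sum_finset_product ((Finset.range k).map e.toEmbedding) Finset.univ
      (fun n => Finset.range (M n k)), Finset.sum_map]
    · rfl
    · rintro ⟨n, m⟩
      rw [Finset.mem_range, hM, ← Finset.mem_range]
      simp
  simp only [hsum]
  exact tendsto_finsetSum _ fun n _ => (hS n).comp (hMlim n)

theorem hasSumInOrder_later {B : Type*} [AddCommMonoid B] [TopologicalSpace B]
    [ContinuousAdd B] (hN : 1 ≤ N) (hθ : Function.Injective θ)
    (hanti : ∀ n, StrictAnti fun m => ‖lam n m‖) (hlim : ∀ n, Tendsto (lam n) atTop (𝓝 0))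
    (a : Fin N × ℕ → B) (S : Fin N → B)
    (hS : ∀ n, Tendsto (fun M => ∑ m ∈ Finset.range M, a (n, m)) atTop (𝓝 (S n))) :
    HasSumInOrder (Later θ lam) a (∑ n, S n) := by
  have : Nonempty (Fin N) := ⟨⟨0, hN⟩⟩
  obtain ⟨e, he⟩ := exists_equiv_of_finite_predecessors (r := Later θ lam) Later.irrefl
    (fun _ _ _ => Later.trans) (Later.trichotomy hθ hanti) (finite_setOf_later hanti hlim)
  refine ⟨e, he, tendsto_sum_range_of_rows e (fun n m m' hmm' => ?_) a S hS⟩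
  have hlater : Later θ lam (n, m') (n, m) := Or.inl (hanti n hmm')
  by_contra hle
  rcases (not_lt.1 hle).eq_or_lt with h | h
  · exact hmm'.ne' (Prod.ext_iff.1 (e.symm.injective h)).2
  · have h' := he _ _ h
    rw [e.apply_symm_apply, e.apply_symm_apply] at h'
    exact Later.irrefl _ (hlater.trans h')

end Order

/-! ### The functional calculus -/

theorem isBounded_zero_union_rows {N : ℕ} {lam : Fin N → ℕ → ℂ}
    (hlim : ∀ n, Tendsto (lam n) atTop (𝓝 0)) :
    Bornology.IsBounded ({0} ∪ {z | ∃ n m, z = lam n m}) := by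
  refine Bornology.isBounded_singleton.union ?_
  have h : {z | ∃ n m, z = lam n m} = ⋃ n, Set.range (lam n) := by
    ext z
    simp [eq_comm]
  rw [h, Bornology.isBounded_iUnion]
  exact fun n => Metric.isBounded_range_of_tendsto _ (hlim n)

/-- Along one ray the series `∑ (f (λ m) - f 0) E m` converges for every `f ∈ AC(σ)`, and its sum
has norm at most `K var(f, σ)`. -/
theorem exists_tendsto_sum_ray {B : Type*} [NormedAddCommGroup B] [NormedSpace ℂ B]
    [CompleteSpace B] {σ : Set ℂ} {f : σ → ℂ} (hf : f ∈ AC σ) {θ : ℝ} {z : ℕ → σ} {z₀ : σ}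
    (hz : ∀ m, (z m : ℂ) ∈ ray θ) (hanti : Antitone fun m => ‖(z m : ℂ)‖)
    (hlim : Tendsto z atTop (𝓝 z₀)) {E : ℕ → B} {K : ℝ}
    (hK : ∀ M, ‖∑ m ∈ Finset.range (M + 1), E m‖ ≤ K) :
    ∃ L : B, Tendsto (fun M => ∑ m ∈ Finset.range M, (f (z m) - f z₀) • E m) atTop (𝓝 L) ∧
      ‖L‖ ≤ K * (var f).toReal := by
  have hvar : var f ≠ ∞ := (le_add_self.trans_lt (bvENorm_lt_top_of_mem_AC hf)).ne
  refine exists_tendsto_sum_smul ?_ (fun n => ?_) hK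
  · rw [← sub_self (f z₀)]
    exact (((continuous_of_mem_AC hf).tendsto z₀).comp hlim).sub_const _
  · have h := ENNReal.toReal_mono hvar (sum_edist_le_var_of_ray f z hz hanti n)
    rw [ENNReal.toReal_sum fun m _ => edist_ne_top _ _] at h
    simpa [edist_dist, dist_eq_norm] using h

theorem norm_apply_add_var_le {σ : Set ℂ} {f : σ → ℂ} (hf : f ∈ AC σ) (z : σ) :
    ‖f z‖ + (var f).toReal ≤ bvNorm f := by
  have htop := bvENorm_lt_top_of_mem_AC hf
  have hvar : var f ≠ ∞ := (le_add_self.trans_lt htop).ne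
  have hsup : supENorm f ≠ ∞ := (le_self_add.trans_lt htop).ne
  have h := ENNReal.toReal_mono hsup (le_supENorm f z)
  rw [toReal_enorm] at h
  rw [bvNorm, bvENorm, ENNReal.toReal_add hsup hvar]
  linarith

/-- A family of unital algebra homomorphisms which converges pointwise has a unital algebra
homomorphism as its limit; the homomorphisms are given by their values and algebraic laws. -/
theorem exists_algHom_of_tendsto {R A : Type*} [CommRing R] [Algebra ℂ R] [NormedRing A]
    [NormedAlgebra ℂ A] {Ψ : ℕ → R → A} {ψ : R → A}
    (hlim : ∀ f, Tendsto (fun M => Ψ M f) atTop (𝓝 (ψ f)))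
    (hadd : ∀ M f g, Ψ M (f + g) = Ψ M f + Ψ M g) (hmul : ∀ M f g, Ψ M (f * g) = Ψ M f * Ψ M g)
    (halg : ∀ M c, Ψ M (algebraMap ℂ R c) = algebraMap ℂ A c) :
    ∃ φ : R →ₐ[ℂ] A, ∀ f, φ f = ψ f := by
  have hcomm : ∀ c, ψ (algebraMap ℂ R c) = algebraMap ℂ A c := fun c =>
    tendsto_nhds_unique (hlim _) (by simp only [halg]; exact tendsto_const_nhds)
  have hadd' : ∀ f g, ψ (f + g) = ψ f + ψ g := fun f g =>
    tendsto_nhds_unique (hlim _) (by simp only [hadd]; exact (hlim f).add (hlim g))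
  have hmul' : ∀ f g, ψ (f * g) = ψ f * ψ g := fun f g =>
    tendsto_nhds_unique (hlim _) (by simp only [hmul]; exact (hlim f).mul (hlim g))
  exact ⟨{ toFun := ψ
           map_one' := by simpa using hcomm 1
           map_mul' := hmul'
           map_zero' := by simpa using hcomm 0
           map_add' := hadd'
           commutes' := hcomm }, fun _ => rfl⟩

/-- The functional calculus `f ↦ f(z₀) 1 + ∑ n, L f n` in a Banach algebra, where `L f n` is the sum
of the series along the `n`-th ray and `z₀` is the common limit of the eigenvalues. The bound
`‖1‖ ≤ 1` (rather than `= 1`) admits the operators on the zero space. -/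
theorem exists_calculus {A : Type*} [NormedRing A] [NormedAlgebra ℂ A] [CompleteSpace A]
    (hone : ‖(1 : A)‖ ≤ 1) {N : ℕ} {θ : Fin N → ℝ} {E : Fin N → ℕ → A} {σ : Set ℂ}
    {z : Fin N → ℕ → σ} {z₀ : σ} (hray : ∀ n m, (z n m : ℂ) ∈ ray (θ n))
    (hanti : ∀ n, Antitone fun m => ‖(z n m : ℂ)‖) (hlim : ∀ n, Tendsto (z n) atTop (𝓝 z₀))
    (hproj : ∀ n m, IsIdempotentElem (E n m))
    (hdisj : ∀ n m n' m', (n, m) ≠ (n', m') → E n m * E n' m' = 0) {K : ℝ}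
    (hK : ∀ n M, ‖∑ m ∈ Finset.range (M + 1), E n m‖ ≤ K) :
    ∃ (ψ : AC σ →ₐ[ℂ] A) (L : AC σ → Fin N → A),
      (∀ f : AC σ, ∀ n, Tendsto (fun M => ∑ m ∈ Finset.range M,
        ((f : σ → ℂ) (z n m) - (f : σ → ℂ) z₀) • E n m) atTop (𝓝 (L f n))) ∧
      (∀ f : AC σ, ψ f = (f : σ → ℂ) z₀ • (1 : A) + ∑ n, L f n) ∧
      ∀ f : AC σ, ‖ψ f‖ ≤ (N + 1) * max 1 K * bvNorm (f : σ → ℂ) := by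
  have hL : ∀ (f : AC σ) (n : Fin N), ∃ L : A,
      Tendsto (fun M => ∑ m ∈ Finset.range M, ((f : σ → ℂ) (z n m) - (f : σ → ℂ) z₀) • E n m)
        atTop (𝓝 L) ∧ ‖L‖ ≤ K * (var (f : σ → ℂ)).toReal := fun f n =>
    exists_tendsto_sum_ray f.2 (hray n) (hanti n) (hlim n) (hK n)
  choose L hLlim hLnorm using hL
  -- the calculus is a limit of the homomorphisms which only see finitely many projections
  let Ψ : ℕ → AC σ → A := fun M f =>
    spectralSum (fun i : Fin N × ℕ => E i.1 i.2) (Finset.univ ×ˢ Finset.range M)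
      ((f : σ → ℂ) z₀) (fun i => (f : σ → ℂ) (z i.1 i.2))
  have hΨ : ∀ f, Tendsto (fun M => Ψ M f) atTop
      (𝓝 ((f : σ → ℂ) z₀ • (1 : A) + ∑ n, L f n)) := by
    intro f
    simp only [Ψ, spectralSum, Finset.sum_product]
    exact tendsto_const_nhds.add (tendsto_finsetSum _ fun n _ => hLlim f n)
  obtain ⟨ψ, hψ⟩ := exists_algHom_of_tendsto hΨ
    (fun M f g => spectralSum_add _ _ _ _ _ _)
    (fun M f g => spectralSum_mul (E := fun i : Fin N × ℕ => E i.1 i.2)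
      (fun i => hproj i.1 i.2) (fun i j hij => hdisj i.1 i.2 j.1 j.2 hij) _ _ _ _ _)
    (fun M c => spectralSum_const _ _ c)
  refine ⟨ψ, L, hLlim, hψ, fun f => ?_⟩
  have hv : 0 ≤ (var (f : σ → ℂ)).toReal := ENNReal.toReal_nonneg
  have hle := norm_apply_add_var_le f.2 z₀
  have hf0 := norm_nonneg ((f : σ → ℂ) z₀)
  have hbv : 0 ≤ bvNorm (f : σ → ℂ) := ENNReal.toReal_nonneg
  calc ‖ψ f‖ ≤ ‖(f : σ → ℂ) z₀ • (1 : A)‖ + ‖∑ n, L f n‖ := by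
        rw [hψ]; exact norm_add_le _ _
    _ ≤ ‖(f : σ → ℂ) z₀‖ * 1 + ∑ _n : Fin N, K * (var (f : σ → ℂ)).toReal := by
        refine add_le_add ?_ (norm_sum_le_of_le _ fun n _ => hLnorm f n)
        rw [norm_smul]
        gcongr
    _ = ‖(f : σ → ℂ) z₀‖ + N * K * (var (f : σ → ℂ)).toReal := by
        rw [Finset.sum_const, Finset.card_univ, Fintype.card_fin, nsmul_eq_mul, mul_one,
          mul_assoc]
    _ ≤ max 1 K * bvNorm (f : σ → ℂ)
          + N * max 1 K * bvNorm (f : σ → ℂ) := by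
        refine add_le_add ?_ ?_
        · calc ‖(f : σ → ℂ) z₀‖ ≤ bvNorm (f : σ → ℂ) := by linarith
            _ ≤ _ := le_mul_of_one_le_left hbv (le_max_left _ _)
        · gcongr
          · exact le_max_right _ _
          · linarith
    _ = (N + 1) * max 1 K * bvNorm (f : σ → ℂ) := by ring

end ACOp

theorem mainTheorem1 {X : Type*} [NormedAddCommGroup X] [NormedSpace ℂ X] [CompleteSpace X]
    (N : ℕ) (hN : 1 ≤ N)
    (θ : Fin N → ℝ) (hθ : ∀ n, θ n ∈ Set.Ico 0 (2 * Real.pi)) (hθ_inj : Function.Injective θ)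
    (lam : Fin N → ℕ → ℂ) (E : Fin N → ℕ → X →L[ℂ] X)
    -- the scalars lie on the rays
    (hray : ∀ n m, lam n m ∈ ACOp.ray (θ n))
    -- on each ray the moduli strictly decrease to 0
    (hanti : ∀ n, StrictAnti fun m => ‖lam n m‖)
    (hlim : ∀ n, Tendsto (lam n) atTop (𝓝 0))
    -- pairwise disjoint finite rank projections with bounded partial sums along each ray
    (hproj : ∀ n m, IsIdempotentElem (E n m))
    (hfin : ∀ n m, FiniteDimensional ℂ (LinearMap.range (E n m : X →ₗ[ℂ] X)))
    (hdisj : ∀ n m n' m', (n, m) ≠ (n', m') → E n m * E n' m' = 0)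
    (K : ℝ) (hK : ∀ n M, ‖∑ m ∈ Finset.range (M + 1), E n m‖ ≤ K)
    (σ : Set ℂ) (hσ : σ = {0} ∪ {z | ∃ n m, z = lam n m}) :
    ∃ T : X →L[ℂ] X,
      ACOp.HasSumInOrder (ACOp.Later θ lam) (fun i : Fin N × ℕ => lam i.1 i.2 • E i.1 i.2) T ∧
      IsCompactOperator T ∧
      ACOp.IsACOperator σ T ∧
      ∃ ψ : ACOp.AC σ →ₐ[ℂ] (X →L[ℂ] X),
        ACOp.IsACFunctionalCalculus σ T ψ ∧
        ∀ f : ACOp.AC σ, ‖ψ f‖ ≤ (2 * N + 1) * max 1 K * ACOp.bvNorm (f : σ → ℂ) := by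
  have hbdd : Bornology.IsBounded σ := hσ ▸ ACOp.isBounded_zero_union_rows hlim
  let z₀ : σ := ⟨0, by simp [hσ]⟩
  let z : Fin N → ℕ → σ := fun n m => ⟨lam n m, by rw [hσ]; exact Or.inr ⟨n, m, rfl⟩⟩
  have hz : ∀ n, Tendsto (z n) atTop (𝓝 z₀) := fun n => tendsto_subtype_rng.2 (hlim n)
  obtain ⟨ψ, L, hLlim, hψ, hψnorm⟩ := ACOp.exists_calculus (A := X →L[ℂ] X)
    ContinuousLinearMap.norm_id_le (z := z) hray (fun n => (hanti n).antitone) hz hproj hdisj hK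
  have hbound : ∀ f : ACOp.AC σ,
      ‖ψ f‖ ≤ (2 * N + 1) * max 1 K * ACOp.bvNorm (f : σ → ℂ) := by
    intro f
    have hbv : 0 ≤ ACOp.bvNorm (f : σ → ℂ) := ENNReal.toReal_nonneg
    refine (hψnorm f).trans ?_
    gcongr
    have : (0 : ℝ) ≤ N := Nat.cast_nonneg N
    linarith
  let g : ACOp.AC σ := ⟨fun w : σ => (w : ℂ), ACOp.coe_mem_AC hbdd⟩
  have hg : ψ g = ∑ n, L g n := by
    rw [hψ]
    simp [g, z₀]
  have hgray : ∀ n, Tendsto (fun M => ∑ m ∈ Finset.range M, lam n m • E n m) atTop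
      (𝓝 (L g n)) := fun n => by simpa [g, z, z₀] using hLlim g n
  have hcalc : ACOp.IsACFunctionalCalculus σ (∑ n, L g n) ψ :=
    ⟨⟨_, hbound⟩, g, fun _ => rfl, hg⟩
  refine ⟨∑ n, L g n, ACOp.hasSumInOrder_later hN hθ_inj hanti hlim _ _ hgray, ?_, ⟨ψ, hcalc⟩, ψ,
    hcalc, hbound⟩
  have hcompact : ∀ n, IsCompactOperator (L g n) := fun n =>
    isCompactOperator_of_tendsto (hgray n) <| Eventually.of_forall fun M =>
      (compactOperator (RingHom.id ℂ) X X).sum_mem fun m _ =>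
        (compactOperator (RingHom.id ℂ) X X).smul_mem _
          (ACOp.isCompactOperator_of_finiteDimensional_range (E n m) (hfin n m))
  exact (compactOperator (RingHom.id ℂ) X X).sum_mem fun n _ => hcompact n
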